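/- Let $E$ be a (real or complex) Banach space that contains no isomorphic copy of $c_0$, let $m\ge 1$, let $T_1,\dots,T_m$ be commuting power-bounded linear operators on $E$ (i.e. $\sup_n\|T_j^n\|<\infty$ for each $j$), and let $\mathcal S$ be the operator semigroup generated by $T_1,\dots,T_m$. Put $$E_{\mathrm{aap}}=\{y\in E : \mathcal S y=\{Sy : S\in\mathcal S\}\text{ is relatively compact}\},$$ an $\mathcal S$-invariant subspace of $E$, and let $\overline{\mathcal S}$ be the closure of the restricted semigroup $\mathcal S|_{E_{\mathrm{aap}}}$ in $\mathscr L(E_{\mathrm{aap}})$ with respect to the strong operator topology. There is a unique projection $P\in\overline{\mathcal S}$ (the Jacobs–de Leeuw–Glicksberg projection) such that $\overline{\mathcal S}$ restricted to $\operatorname{rg}P$ is a compact topological group (for the strong operator topology) and $\overline{\mathcal S}$ restricted to $\ker P$ contains the zero operator. For this $P$ and every $x\in E$ the following assertions are equivalent: (a) $\mathcal S x$ is relatively compact. (b) $\mathcal S(I-T_j)x=\{S(x-T_jx) : S\in\mathcal S\}$ is relatively compact for every $j\in\{1,\dots,m\}$, and $(I-P)(I-\mathcal S)x=\{(I-P)(x-Sx)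 : S\in\mathcal S\}$ is relatively compact. (The first condition in (b) implies that $x-Sx\in E_{\mathrm{aap}}$ for all $S\in\mathcal S$, so that the second condition makes sense.) -/

import Mathlib

open scoped Pointwise ZeroAtInfty

namespace OrbitCompactness

section Basic

variable {𝕜 : Type*} [RCLike 𝕜] {E : Type*} [NormedAddCommGroup E] [NormedSpace 𝕜 E]

/-- A subset of a topological space is relatively compact if its closure is compact. -/
def RelCompact {X : Type*} [TopologicalSpace X] (A : Set X) : Prop :=
  IsCompact (closure A)

variable (𝕜 E) in
/-- `E` contains an isomorphic copy of the Banach space `c₀` of null sequences with the supremum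
norm: some linear subspace of `E` is linearly homeomorphic to `c₀`. -/
def ContainsCZero : Prop :=
  ∃ F : Submodule 𝕜 E, Nonempty (C₀(ℕ, 𝕜) ≃L[𝕜] F)

/-- `T` is power-bounded: `sup_n ‖T ^ n‖ < ∞`. -/
def IsPowerBounded (T : E →L[𝕜] E) : Prop :=
  ∃ C : ℝ, ∀ n : ℕ, ‖T ^ n‖ ≤ C

/-- The operator semigroup generated by `T₁, …, Tₘ` (with composition as multiplication). -/
def generatedSemigroup {m : ℕ} (T : Fin m → E →L[𝕜] E) : Subsemigroup (E →L[𝕜] E) :=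
  Subsemigroup.closure (Set.range T)

/-- The orbit `𝒮 x = {S x ∣ S ∈ 𝒮}`. -/
def orbit (S : Subsemigroup (E →L[𝕜] E)) (x : E) : Set E :=
  {y | ∃ R ∈ S, R x = y}

theorem relCompact_add {A B C : Set E} (hA : RelCompact A) (hB : RelCompact B)
    (h : C ⊆ A + B) : RelCompact C :=
  (IsCompact.add hA hB).closure_of_subset
    (h.trans (Set.add_subset_add subset_closure subset_closure))

/-- The subspace `E_aap = {x ∈ E ∣ 𝒮 x is relatively compact}`. -/
def aap (S : Subsemigroup (E →L[𝕜] E)) : Submodule 𝕜 E where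
  carrier := {x | RelCompact (orbit S x)}
  zero_mem' := (isCompact_singleton (x := (0 : E))).closure_of_subset (by
    rintro _ ⟨R, _, rfl⟩
    simp)
  add_mem' := by
    intro x y hx hy
    refine relCompact_add hx hy ?_
    rintro _ ⟨R, hR, rfl⟩
    exact ⟨R x, ⟨R, hR, rfl⟩, R y, ⟨R, hR, rfl⟩, (map_add R x y).symm⟩
  smul_mem' := by
    intro c x hx
    refine (IsCompact.smul c hx).closure_of_subset ?_
    rintro _ ⟨R, hR, rfl⟩
    exact ⟨R x, subset_closure ⟨R, hR, rfl⟩, (map_smul R c x).symm⟩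

theorem mem_aap {S : Subsemigroup (E →L[𝕜] E)} {x : E} :
    x ∈ aap S ↔ RelCompact (orbit S x) :=
  Iff.rfl

theorem apply_mem_aap {S : Subsemigroup (E →L[𝕜] E)} {R : E →L[𝕜] E} (hR : R ∈ S) {x : E}
    (hx : x ∈ aap S) : R x ∈ aap S := by
  refine IsCompact.closure_of_subset hx ?_
  rintro _ ⟨Q, hQ, rfl⟩
  exact subset_closure ⟨Q * R, S.mul_mem hQ hR, rfl⟩

/-- If the differences with respect to the generators belong to `E_aap`, then so do all
differences `(I - R) x` for `R` in the generated semigroup. -/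
theorem sub_apply_mem_aap {m : ℕ} {T : Fin m → E →L[𝕜] E} {x : E}
    (h : ∀ j, RelCompact (orbit (generatedSemigroup T) (x - T j x)))
    {R : E →L[𝕜] E} (hR : R ∈ generatedSemigroup T) :
    x - R x ∈ aap (generatedSemigroup T) := by
  induction hR using Subsemigroup.closure_induction with
  | mem R hR =>
    obtain ⟨j, rfl⟩ := hR
    exact h j
  | mul R Q hR hQ ihR ihQ =>
    have : x - (R * Q) x = (x - R x) + R (x - Q x) := by simp
    rw [this]
    exact add_mem ihR (apply_mem_aap hR ihQ)

/-- The restrictions to the subspace `F` of those operators in `𝒯` which leave `F` invariant. -/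
def restrictTo (𝒯 : Set (E →L[𝕜] E)) (F : Submodule 𝕜 E) : Set (F →L[𝕜] F) :=
  {A | ∃ R ∈ 𝒯, ∀ y : F, (A y : E) = R y}

/-- Every operator of `𝒮` leaves `E_aap` invariant, so it has a restriction in `𝒮|E_aap`. -/
theorem exists_restrictTo_aap {S : Subsemigroup (E →L[𝕜] E)} {R : E →L[𝕜] E} (hR : R ∈ S) :
    ∃ A ∈ restrictTo (S : Set (E →L[𝕜] E)) (aap S), ∀ y : aap S, (A y : E) = R y :=
  ⟨R.restrict (fun _ hy => apply_mem_aap hR hy), ⟨R, hR, fun _ => rfl⟩, fun _ => rfl⟩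

/-- The identity map from bounded operators with the norm topology to bounded operators with the
strong operator topology. -/
def toSOT : (E →L[𝕜] E) ≃ (E →Lₚₜ[𝕜] E) :=
  UniformConvergenceCLM.ofFun (RingHom.id 𝕜) E {s : Set E | Finite s}

/-- The closure of a set of operators in the strong operator topology. -/
def sotClosure (𝒯 : Set (E →L[𝕜] E)) : Set (E →L[𝕜] E) :=
  toSOT ⁻¹' closure (toSOT '' 𝒯)

/-- The set `G` of operators on `E` is, with composition and the strong operator topology, a
compact topological group whose neutral element is the identity operator. -/
structure IsCompactOperatorGroup (G : Set (E →L[𝕜] E)) : Prop where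
  one_mem : 1 ∈ G
  mul_mem : ∀ A ∈ G, ∀ B ∈ G, A * B ∈ G
  exists_inv : ∀ A ∈ G, ∃ B ∈ G, A * B = 1 ∧ B * A = 1
  isCompact : IsCompact (toSOT '' G)
  continuousOn_mul :
    ContinuousOn (fun p : (E →Lₚₜ[𝕜] E) × (E →Lₚₜ[𝕜] E) =>
      toSOT (toSOT.symm p.1 * toSOT.symm p.2)) ((toSOT '' G) ×ˢ (toSOT '' G))
  continuousOn_inv :
    ContinuousOn (fun A : E →Lₚₜ[𝕜] E => toSOT (Ring.inverse (toSOT.symm A))) (toSOT '' G)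

end Basic

section Projection

variable {𝕜 : Type*} [RCLike 𝕜] {E : Type*} [NormedAddCommGroup E] [NormedSpace 𝕜 E]

/-- For a set `𝒯` of operators on `E`, the operator `P` on `E` is a projection as in the
Jacobs–de Leeuw–Glicksberg decomposition of `𝒯`: it is a projection in the strong operator closure
of `𝒯`, this closure restricts to a compact topological group on the range of `P`, and its
restriction to the kernel of `P` contains the zero operator. -/
structure IsJdLGProjection (𝒯 : Set (E →L[𝕜] E)) (P : E →L[𝕜] E) : Prop where
  mem_sotClosure : P ∈ sotClosure 𝒯
  isIdempotentElem : IsIdempotentElem P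
  group_on_range :
    IsCompactOperatorGroup (restrictTo (sotClosure 𝒯) (LinearMap.range (P : E →ₗ[𝕜] E)))
  zero_on_ker :
    (0 : LinearMap.ker (P : E →ₗ[𝕜] E) →L[𝕜] LinearMap.ker (P : E →ₗ[𝕜] E)) ∈
      restrictTo (sotClosure 𝒯) (LinearMap.ker (P : E →ₗ[𝕜] E))

/-- `P` is the Jacobs–de Leeuw–Glicksberg projection on `E_aap` of the semigroup `𝒮`, i.e. the one
of the restricted semigroup `𝒮|E_aap`. -/
def IsAapProjection (S : Subsemigroup (E →L[𝕜] E)) (P : aap S →L[𝕜] aap S) : Prop :=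
  IsJdLGProjection (restrictTo (S : Set (E →L[𝕜] E)) (aap S)) P

/-- The set `(I - P)(I - 𝒮) x`, where `P` acts on `E_aap`: all vectors `y - P y` for the elements
`y` of `E_aap` of the form `y = x - R x` with `R ∈ 𝒮`. -/
def stableDifferences (S : Subsemigroup (E →L[𝕜] E)) (P : aap S →L[𝕜] aap S) (x : E) : Set E :=
  {z | ∃ R ∈ S, ∃ y : aap S, (y : E) = x - R x ∧ z = y - P y}

end Projection

end OrbitCompactness

/-!
If the differences `x - R x` lie in `E_aap`, then `g ↦ P (x - g x)` is a bounded cocycle of the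
commutative monoid `𝒮 ∪ {1}` with values in `rg P`, where `𝒮` acts by a relatively compact group and
hence uniformly bounded below. The equivalence amounts to the total boundedness of its range.

If the range is not totally bounded, it contains an infinite sequence of uniformly separated values.
By Dickson's lemma the corresponding elements of the monoid may be taken to divide their successors,
and by compactness of the orbits in `E_aap` two of them act almost equally on finitely many given
vectors. Their quotient then acts almost trivially on these vectors, while the cocycle is bounded
away from zero at it. Iterating gives a sequence of values of the cocycle, bounded away from zero,
each finite sum of which is close to a value of the cocycle. So all finite sums are bounded, and
`E` contains `c₀` by the Bessaga–Pełczyński theorem.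
-/

namespace OrbitCompactness

open Filter Topology

section CZero

/-- Rosenthal's disjointification lemma, for matrices. -/
theorem exists_offDiagonal_sum_le {ε : ℝ} (hε : 0 ≤ ε) (n : ℕ) :
    ∀ a : ℕ → ℕ → ℝ, (∀ i (F : Finset ℕ), ∑ j ∈ F, a i j ≤ n * ε) →
      ∃ φ : ℕ → ℕ, Function.Injective φ ∧
        ∀ i (F : Finset ℕ), i ∉ F → ∑ j ∈ F, a (φ i) (φ j) ≤ ε := by
  have pair_right_injective (p : ℕ) : Function.Injective (Nat.pair p) :=
    fun _ _ h => (Nat.pair_eq_pair.1 h).2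
  have pair_graph_injective (f : ℕ → ℕ) : Function.Injective fun p => Nat.pair p (f p) :=
    fun _ _ h => (Nat.pair_eq_pair.1 h).1
  induction n with
  | zero =>
    intro a h
    exact ⟨id, Function.injective_id, fun i F _ => (h i F).trans (by simpa using hε)⟩
  | succ n ih =>
    intro a h
    -- The columns of `ℕ × ℕ ≃ ℕ` are disjoint infinite sets: either one of them works, or each of
    -- them contains a row with an off-diagonal sum above `ε`, which leaves at most `n * ε` for the
    -- sums over the rows so chosen.
    by_cases hp : ∃ p, ∀ i (F : Finset ℕ), i ∉ F →
        ∑ j ∈ F, a (Nat.pair p i) (Nat.pair p j) ≤ ε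
    · obtain ⟨p, hp⟩ := hp
      exact ⟨Nat.pair p, pair_right_injective p, hp⟩
    push Not at hp
    choose i F hiF hF using hp
    have row_sum_le (p : ℕ) (G : Finset ℕ) :
        ∑ q ∈ G, a (Nat.pair p (i p)) (Nat.pair q (i q)) ≤ n * ε := by
      have hdisj : Disjoint (G.image fun q => Nat.pair q (i q)) ((F p).image (Nat.pair p)) := by
        simp only [Finset.disjoint_left, Finset.mem_image, not_exists, not_and]
        rintro _ ⟨q, _, rfl⟩ j hj hjq
        obtain ⟨rfl, rfl⟩ := Nat.pair_eq_pair.1 hjq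
        exact hiF _ hj
      have hsum := h (Nat.pair p (i p)) ((G.image fun q => Nat.pair q (i q)) ∪
        ((F p).image (Nat.pair p)))
      rw [Finset.sum_union hdisj, Finset.sum_image (pair_graph_injective i).injOn,
        Finset.sum_image (pair_right_injective p).injOn] at hsum
      push_cast at hsum
      linarith [hF p]
    obtain ⟨φ, hφ, hoff⟩ := ih _ row_sum_le
    exact ⟨fun k => Nat.pair (φ k) (i (φ k)), (pair_graph_injective i).comp hφ, hoff⟩

theorem sum_abs_le_of_forall_abs_sum_le {ι : Type*} {r : ι → ℝ} {C : ℝ}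
    (h : ∀ F : Finset ι, |∑ i ∈ F, r i| ≤ C) (F : Finset ι) : ∑ i ∈ F, |r i| ≤ 2 * C := by
  have hpos : ∑ i ∈ F with 0 ≤ r i, |r i| = ∑ i ∈ F with 0 ≤ r i, r i :=
    Finset.sum_congr rfl fun i hi => abs_of_nonneg (Finset.mem_filter.1 hi).2
  have hneg : ∑ i ∈ F with ¬ 0 ≤ r i, |r i| = -∑ i ∈ F with ¬ 0 ≤ r i, r i := by
    rw [← Finset.sum_neg_distrib]
    exact Finset.sum_congr rfl fun i hi =>
      abs_of_nonpos (le_of_lt (not_le.1 (Finset.mem_filter.1 hi).2))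
  rw [← Finset.sum_filter_add_sum_filter_not F (fun i => 0 ≤ r i), hpos, hneg]
  linarith [(abs_le.1 (h (F.filter fun i => 0 ≤ r i))).2,
    (abs_le.1 (h (F.filter fun i => ¬ 0 ≤ r i))).1]

variable {𝕜 : Type*} [RCLike 𝕜]

theorem sum_norm_le_of_forall_norm_sum_le {ι : Type*} {z : ι → 𝕜} {C : ℝ}
    (h : ∀ F : Finset ι, ‖∑ i ∈ F, z i‖ ≤ C) (F : Finset ι) : ∑ i ∈ F, ‖z i‖ ≤ 4 * C := by
  have hre := sum_abs_le_of_forall_abs_sum_le (r := fun i => RCLike.re (z i)) (C := C)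
    (fun G => by rw [← map_sum]; exact (RCLike.abs_re_le_norm _).trans (h G)) F
  have him := sum_abs_le_of_forall_abs_sum_le (r := fun i => RCLike.im (z i)) (C := C)
    (fun G => by rw [← map_sum]; exact (RCLike.abs_im_le_norm _).trans (h G)) F
  have norm_le (w : 𝕜) : ‖w‖ ≤ |RCLike.re w| + |RCLike.im w| := by
    refine abs_le_of_sq_le_sq' ?_ (by positivity) |>.2
    rw [RCLike.norm_sq_eq_def, add_sq, sq_abs, sq_abs]
    nlinarith [mul_nonneg (abs_nonneg (RCLike.re w)) (abs_nonneg (RCLike.im w))]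
  calc ∑ i ∈ F, ‖z i‖ ≤ ∑ i ∈ F, (|RCLike.re (z i)| + |RCLike.im (z i)|) :=
        Finset.sum_le_sum fun i _ => norm_le (z i)
    _ ≤ 4 * C := by rw [Finset.sum_add_distrib]; linarith

variable {E : Type*} [NormedAddCommGroup E] [NormedSpace 𝕜 E]

section BoundedSums

variable {ι : Type*} {x : ι → E} {C : ℝ}

theorem sum_norm_dual_apply_le (hC : ∀ F : Finset ι, ‖∑ k ∈ F, x k‖ ≤ C) {f : StrongDual 𝕜 E}
    (hf : ‖f‖ ≤ 1) (F : Finset ι) : ∑ k ∈ F, ‖f (x k)‖ ≤ 4 * C := by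
  refine sum_norm_le_of_forall_norm_sum_le (fun G => ?_) F
  rw [← map_sum]
  exact (f.le_of_opNorm_le hf _).trans (by simpa using hC G)

theorem norm_sum_smul_le (hC : ∀ F : Finset ι, ‖∑ k ∈ F, x k‖ ≤ C) {a : ι → 𝕜} {F : Finset ι}
    {r : ℝ} (hr : 0 ≤ r) (ha : ∀ k ∈ F, ‖a k‖ ≤ r) : ‖∑ k ∈ F, a k • x k‖ ≤ 4 * C * r := by
  obtain ⟨f, hf, hfx⟩ := exists_dual_vector'' 𝕜 (∑ k ∈ F, a k • x k)
  calc ‖∑ k ∈ F, a k • x k‖ = ‖∑ k ∈ F, f (a k • x k)‖ := by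
        rw [← map_sum, hfx, RCLike.norm_ofReal, abs_of_nonneg (norm_nonneg _)]
    _ ≤ ∑ k ∈ F, r * ‖f (x k)‖ := norm_sum_le_of_le _ fun k hk => by
        rw [map_smul, norm_smul]
        exact mul_le_mul_of_nonneg_right (ha k hk) (norm_nonneg _)
    _ ≤ 4 * C * r := by
        rw [← Finset.mul_sum, mul_comm]
        exact mul_le_mul_of_nonneg_right (sum_norm_dual_apply_le hC hf F) hr

theorem summable_smul_of_tendsto_zero [CompleteSpace E]
    (hC : ∀ F : Finset ι, ‖∑ k ∈ F, x k‖ ≤ C) {a : ι → 𝕜} (ha : Tendsto a cofinite (𝓝 0)) :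
    Summable fun k => a k • x k := by
  have hC0 : 0 ≤ C := by simpa using hC ∅
  rw [summable_iff_vanishing_norm]
  intro ε hε
  obtain ⟨r, hr0, hr⟩ : ∃ r > 0, 4 * C * r < ε :=
    ⟨ε / (4 * C + 1), by positivity, by rw [mul_div, div_lt_iff₀ (by positivity)]; linarith⟩
  have hfin : {k | ¬ ‖a k‖ < r}.Finite :=
    (tendsto_zero_iff_norm_tendsto_zero.1 ha).eventually (gt_mem_nhds hr0)
  refine ⟨hfin.toFinset, fun F hF => (norm_sum_smul_le hC hr0.le fun k hk => ?_).trans_lt hr⟩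
  by_contra hk'
  exact Finset.disjoint_left.1 hF hk (hfin.mem_toFinset.2 fun h => hk' h.le)

end BoundedSums

theorem norm_apply_le_norm {α : Type*} [TopologicalSpace α] (a : C₀(α, 𝕜)) (i : α) :
    ‖a i‖ ≤ ‖a‖ :=
  a.toBCF.norm_coe_le_norm i

theorem exists_forall_hasSum_smul [CompleteSpace E] {x : ℕ → E} {C : ℝ}
    (hC : ∀ F : Finset ℕ, ‖∑ k ∈ F, x k‖ ≤ C) :
    ∃ L : C₀(ℕ, 𝕜) →L[𝕜] E, ∀ a, HasSum (fun k => a k • x k) (L a) := by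
  have hsum (a : C₀(ℕ, 𝕜)) : HasSum (fun k => a k • x k) (∑' k, a k • x k) :=
    (summable_smul_of_tendsto_zero hC (cocompact_eq_cofinite ℕ ▸ zero_at_infty a)).hasSum
  let L : C₀(ℕ, 𝕜) →ₗ[𝕜] E :=
    { toFun := fun a => ∑' k, a k • x k
      map_add' := fun a b => HasSum.tsum_eq <| by
        simpa only [ZeroAtInftyContinuousMap.add_apply, add_smul] using (hsum a).add (hsum b)
      map_smul' := fun c a => HasSum.tsum_eq <| by
        simpa only [ZeroAtInftyContinuousMap.smul_apply, smul_assoc, RingHom.id_apply] using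
          (hsum a).const_smul c }
  refine ⟨L.mkContinuous (4 * C) fun a => ?_, hsum⟩
  exact le_of_tendsto (hsum a).norm (Eventually.of_forall fun F =>
    norm_sum_smul_le hC (norm_nonneg _) fun k _ => norm_apply_le_norm a k)

theorem norm_coeff_mul_le {ι : Type*} [DecidableEq ι] {F : Finset ι} {i : ι} (hi : i ∈ F)
    {f : StrongDual 𝕜 E} (hf : ‖f‖ ≤ 1) {a : ι → 𝕜} {r : ℝ} (ha : ∀ k, ‖a k‖ ≤ r) (x : ι → E) :
    ‖a i‖ * ‖f (x i)‖ ≤ ‖∑ k ∈ F, a k • x k‖ + r * ∑ k ∈ F.erase i, ‖f (x k)‖ := by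
  have hsplit : a i * f (x i) =
      f (∑ k ∈ F, a k • x k) - ∑ k ∈ F.erase i, a k * f (x k) := by
    simp [map_sum, ← Finset.add_sum_erase _ _ hi]
  rw [← norm_mul, hsplit, Finset.mul_sum]
  refine (norm_sub_le _ _).trans (add_le_add ?_ (norm_sum_le_of_le _ fun k _ => ?_))
  · simpa using f.le_of_opNorm_le hf (∑ k ∈ F, a k • x k)
  · rw [norm_mul]
    exact mul_le_mul_of_nonneg_right (ha k) (norm_nonneg _)

theorem containsCZero_of_antilipschitz {c : NNReal} {L : C₀(ℕ, 𝕜) →L[𝕜] E}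
    (hL : AntilipschitzWith c L) : ContainsCZero 𝕜 E :=
  have : CompleteSpace L.range := (hL.isComplete_range L.uniformContinuous).completeSpace_coe
  let e : C₀(ℕ, 𝕜) ≃ₗ[𝕜] L.range := LinearEquiv.ofInjective L.toLinearMap hL.injective
  ⟨L.range, ⟨e.toContinuousLinearEquivOfContinuous
    (L.continuous.codRestrict fun x => L.mem_range_self x)⟩⟩

theorem ContainsCZero.of_submodule {F : Submodule 𝕜 E} (h : ContainsCZero 𝕜 F) :
    ContainsCZero 𝕜 E := by
  obtain ⟨G, ⟨e⟩⟩ := h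
  exact containsCZero_of_antilipschitz (L := F.subtypeL ∘L G.subtypeL ∘L e.toContinuousLinearMap)
    (((isometry_subtype_coe.comp isometry_subtype_coe).antilipschitz).comp e.antilipschitz)

/-- The Bessaga–Pełczyński theorem: by `sum_norm_dual_apply_le`, the bound on the finite sums says
that the series is weakly unconditionally Cauchy. -/
theorem containsCZero_of_bounded_sums [CompleteSpace E] {x : ℕ → E} {C δ : ℝ} (hδ : 0 < δ)
    (hx : ∀ k, δ ≤ ‖x k‖) (hC : ∀ F : Finset ℕ, ‖∑ k ∈ F, x k‖ ≤ C) : ContainsCZero 𝕜 E := by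
  choose f hf hfx using fun k => exists_dual_vector'' 𝕜 (x k)
  obtain ⟨n, hn⟩ := exists_nat_ge (4 * C / (δ / 2))
  obtain ⟨φ, hφ, hoff⟩ := exists_offDiagonal_sum_le (ε := δ / 2) (by positivity) n
    (fun i j => ‖f i (x j)‖) (fun i F =>
      (sum_norm_dual_apply_le hC (hf i) F).trans ((div_le_iff₀ (by positivity)).1 hn))
  obtain ⟨L, hL⟩ := exists_forall_hasSum_smul (𝕜 := 𝕜) (x := x ∘ φ) (C := C) fun F => by
    have := hC (F.map ⟨φ, hφ⟩)
    rwa [Finset.sum_map] at this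
  have coeff_le (a : C₀(ℕ, 𝕜)) (i : ℕ) : ‖a i‖ * δ ≤ ‖L a‖ + ‖a‖ * (δ / 2) := by
    refine ge_of_tendsto ((hL a).norm.add_const _) ?_
    filter_upwards [eventually_ge_atTop {i}] with F hF
    calc ‖a i‖ * δ ≤ ‖a i‖ * ‖f (φ i) (x (φ i))‖ := by
          rw [hfx, RCLike.norm_ofReal, abs_of_nonneg (norm_nonneg _)]
          gcongr
          exact hx _
      _ ≤ ‖∑ k ∈ F, a k • x (φ k)‖ + ‖a‖ * ∑ k ∈ F.erase i, ‖f (φ i) (x (φ k))‖ :=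
          norm_coeff_mul_le (Finset.singleton_subset_iff.1 hF) (hf (φ i)) (norm_apply_le_norm a)
            (x ∘ φ)
      _ ≤ ‖∑ k ∈ F, a k • x (φ k)‖ + ‖a‖ * (δ / 2) := by
          gcongr
          exact hoff i _ (Finset.notMem_erase i F)
  have norm_le (a : C₀(ℕ, 𝕜)) : ‖a‖ ≤ (2 / δ).toNNReal * ‖L a‖ := by
    have h : ‖a‖ ≤ (‖L a‖ + ‖a‖ * (δ / 2)) / δ :=
      (BoundedContinuousFunction.norm_le (by positivity)).2 fun i =>
        (le_div_iff₀ hδ).2 (coeff_le a i)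
    rw [le_div_iff₀ hδ] at h
    rw [Real.coe_toNNReal _ (by positivity), div_mul_eq_mul_div, le_div_iff₀ hδ]
    linarith
  exact containsCZero_of_antilipschitz (L.antilipschitz_of_bound norm_le)

end CZero

section Cocycle

theorem exists_separated_seq_of_not_totallyBounded {X : Type*} [PseudoMetricSpace X] {s : Set X}
    (h : ¬ TotallyBounded s) :
    ∃ ε > 0, ∃ u : ℕ → X, (∀ n, u n ∈ s) ∧ ∀ i j, i < j → ε ≤ dist (u j) (u i) := by
  rw [Metric.totallyBounded_iff] at h
  push Not at h
  obtain ⟨ε, hε, h⟩ := h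
  obtain ⟨u, hu⟩ := Set.seq_of_forall_finite_exists
    (P := fun x F => x ∈ s ∧ ∀ y ∈ F, ε ≤ dist x y) fun F hF => by
      obtain ⟨x, hxs, hx⟩ := Set.not_subset.1 (h F hF)
      exact ⟨x, hxs, fun y hy => not_lt.1 fun hxy => hx (Set.mem_biUnion hy hxy)⟩
  exact ⟨ε, hε, u, fun n => (hu n).1, fun i j hij => (hu j).2 _ (Set.mem_image_of_mem u hij)⟩

theorem exists_lt_forall_dist_le {X ι : Type*} [PseudoMetricSpace X] [Finite ι] {K : ι → Set X}
    (hK : ∀ i, IsCompact (K i)) {x : ℕ → ι → X} (hx : ∀ n i, x n i ∈ K i) {η : ℝ} (hη : 0 < η) :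
    ∃ m n, m < n ∧ ∀ i, dist (x n i) (x m i) ≤ η := by
  have := Fintype.ofFinite ι
  obtain ⟨_, -, φ, hφ, hlim⟩ :=
    (isCompact_univ_pi hK).tendsto_subseq (x := x) fun n i _ => hx n i
  obtain ⟨N, hN⟩ := Metric.cauchySeq_iff.1 hlim.cauchySeq η hη
  exact ⟨φ N, φ (N + 1), hφ N.lt_succ_self, fun i =>
    (dist_le_pi_dist _ _ i).trans (hN _ N.le_succ _ le_rfl).le⟩

variable {𝕜 : Type*} [RCLike 𝕜] {X : Type*} [NormedAddCommGroup X] [NormedSpace 𝕜 X]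
  {N : Type*} [Monoid N] {ρ : N →* (X →L[𝕜] X)} {b : N → X}

/-- `b` is a cocycle (crossed homomorphism) for the representation `ρ` of the monoid `N`. The
model is `b g = x - ρ g x` for a vector `x` in a space to which `ρ` extends. -/
def IsCocycle (ρ : N →* (X →L[𝕜] X)) (b : N → X) : Prop :=
  ∀ g h, b (g * h) = b g + ρ g (b h)

theorem IsCocycle.map_one (hb : IsCocycle ρ b) : b 1 = 0 := by
  simpa using hb 1 1

theorem IsCocycle.map (hb : IsCocycle ρ b) {P : X →L[𝕜] X} (hP : ∀ g, Commute P (ρ g)) :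
    IsCocycle ρ fun g => P (b g) := fun g h =>
  calc P (b (g * h)) = P (b g) + P (ρ g (b h)) := by rw [hb, map_add]
    _ = P (b g) + ρ g (P (b h)) := congrArg _ (DFunLike.congr_fun (hP g).eq (b h))

/-- If `g k` almost fixes the values of a cocycle on all products of the preceding elements, which
are collected in `W k`, then the cocycle is almost additive along `g`. -/
theorem IsCocycle.exists_norm_sub_sum_le (hb : IsCocycle ρ b) {g : ℕ → N} {W : ℕ → Finset N}
    {η : ℕ → ℝ} (hW₀ : 1 ∈ W 0) (hW : ∀ k, ∀ w ∈ W k, w ∈ W (k + 1))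
    (hgW : ∀ k, ∀ w ∈ W k, g k * w ∈ W (k + 1))
    (hη : ∀ k, ∀ w ∈ W k, ‖ρ (g k) (b w) - b w‖ ≤ η k) (k : ℕ) {F : Finset ℕ}
    (hF : F ⊆ Finset.range k) :
    ∃ w ∈ W k, ‖b w - ∑ i ∈ F, b (g i)‖ ≤ ∑ i ∈ Finset.range k, η i := by
  induction k generalizing F with
  | zero =>
    obtain rfl : F = ∅ := by simpa using hF
    exact ⟨1, hW₀, by simp [hb.map_one]⟩
  | succ k ih =>
    rw [Finset.range_add_one, Finset.subset_insert_iff] at hF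
    obtain ⟨w, hw, hwF⟩ := ih hF
    rw [Finset.sum_range_succ]
    by_cases hk : k ∈ F
    · refine ⟨g k * w, hgW k w hw, ?_⟩
      have hsplit : b (g k * w) - ∑ i ∈ F, b (g i) =
          (b w - ∑ i ∈ F.erase k, b (g i)) + (ρ (g k) (b w) - b w) := by
        rw [hb, ← Finset.add_sum_erase _ _ hk]
        abel
      rw [hsplit]
      exact (norm_add_le _ _).trans (add_le_add hwF (hη k w hw))
    · rw [Finset.erase_eq_of_notMem hk] at hwF
      exact ⟨w, hW k w hw, hwF.trans (le_add_of_nonneg_right ((norm_nonneg _).trans (hη k w hw)))⟩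

theorem IsCocycle.containsCZero [CompleteSpace X] (hb : IsCocycle ρ b) {C : ℝ}
    (hC : ∀ g, ‖b g‖ ≤ C) {ε : ℝ} (hε : 0 < ε)
    (h : ∀ (V : Finset N) (η : ℝ), 0 < η →
      ∃ g, ε ≤ ‖b g‖ ∧ ∀ w ∈ V, ‖ρ g (b w) - b w‖ ≤ η) :
    ContainsCZero 𝕜 X := by
  classical
  choose q hqε hq using fun (V : Finset N) (k : ℕ) => h V ((1 / 2) ^ k) (by positivity)
  let W : ℕ → Finset N := Nat.rec {1} fun k V => V ∪ V.image (q V k * ·)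
  let g : ℕ → N := fun k => q (W k) k
  have sum_near_value {n : ℕ} {F : Finset ℕ} (hF : F ⊆ Finset.range n) :
      ∃ w ∈ W n, ‖b w - ∑ i ∈ F, b (g i)‖ ≤ ∑ i ∈ Finset.range n, (1 / 2 : ℝ) ^ i :=
    hb.exists_norm_sub_sum_le (g := g) (Finset.mem_singleton_self 1)
      (fun k w hw => Finset.mem_union_left _ hw)
      (fun k w hw => Finset.mem_union_right _ (Finset.mem_image_of_mem _ hw))
      (fun k w hw => hq _ _ w hw) n hF
  refine containsCZero_of_bounded_sums (x := fun k => b (g k)) (C := C + 2) hε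
    (fun k => hqε _ _) fun F => ?_
  obtain ⟨n, hn⟩ := F.exists_nat_subset_range
  obtain ⟨w, -, hw⟩ := sum_near_value hn
  calc ‖∑ i ∈ F, b (g i)‖ ≤ ‖b w‖ + ‖b w - ∑ i ∈ F, b (g i)‖ := norm_le_insert _ _
    _ ≤ C + 2 := add_le_add (hC w) (hw.trans (sum_geometric_two_le n))

/-- Elements `u (φ i)` and `u (φ j) = u (φ i) * q` with separated values of the cocycle yield a `q`
at which the cocycle is large, since `b (u (φ j)) - b (u (φ i)) = ρ (u (φ i)) (b q)`. By compactness
of the orbits and the lower bound, `q` can be made to act almost trivially. -/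
theorem IsCocycle.totallyBounded_range [CompleteSpace X] (hc0 : ¬ ContainsCZero 𝕜 X)
    (hb : IsCocycle ρ b) {C K : ℝ} (hC : ∀ g, ‖b g‖ ≤ C) (hρ : ∀ g, ‖ρ g‖ ≤ K)
    {Y : Submodule 𝕜 X} (hbY : ∀ g, b g ∈ Y) (hlow : ∀ g, ∀ y ∈ Y, ‖y‖ ≤ K * ‖ρ g y‖)
    (hcpt : ∀ w, RelCompact (Set.range fun g => ρ g (b w)))
    (hdvd : WellQuasiOrdered fun g h : N => g ∣ h) :
    TotallyBounded (Set.range b) := by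
  by_contra hnot
  obtain ⟨ε, hε, y, hy, hsep⟩ := exists_separated_seq_of_not_totallyBounded hnot
  choose u hu using hy
  have : IsPreorder N (· ∣ ·) := { refl := dvd_refl, trans := fun _ _ _ => dvd_trans }
  obtain ⟨φ, hφ⟩ := hdvd.exists_monotone_subseq u
  have large {i j : ℕ} (hij : i < j) {q : N} (hq : u (φ j) = u (φ i) * q) : ε ≤ K * ‖b q‖ :=
    calc ε ≤ ‖b (u (φ j)) - b (u (φ i))‖ := by
          rw [← dist_eq_norm, hu, hu]
          exact hsep _ _ (φ.strictMono hij)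
      _ = ‖ρ (u (φ i)) (b q)‖ := by rw [hq, hb, add_sub_cancel_left]
      _ ≤ K * ‖b q‖ := (ρ _).le_of_opNorm_le (hρ _) _
  have almost_fixed {i j : ℕ} {q w : N} (hq : u (φ j) = u (φ i) * q) :
      ‖ρ q (b w) - b w‖ ≤ K * ‖ρ (u (φ j)) (b w) - ρ (u (φ i)) (b w)‖ := by
    have hmem : ρ q (b w) - b w ∈ Y := by
      rw [← add_sub_cancel_left (b q) (ρ q (b w)), ← hb]
      exact Y.sub_mem (Y.sub_mem (hbY _) (hbY _)) (hbY _)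
    simpa only [hq, map_mul, mul_apply_eq_comp, map_sub] using hlow (u (φ i)) _ hmem
  have hK : 0 < K := by
    obtain ⟨q, hq⟩ := hφ 0 1 zero_le_one
    exact pos_of_mul_pos_left (hε.trans_le (large zero_lt_one hq)) (norm_nonneg _)
  refine hc0 (hb.containsCZero hC (ε := ε / K) (by positivity) fun V η hη => ?_)
  obtain ⟨i, j, hij, hV⟩ := exists_lt_forall_dist_le (fun w : V => hcpt w)
    (x := fun n w => ρ (u (φ n)) (b w)) (fun n w => subset_closure ⟨_, rfl⟩)
    (η := η / K) (by positivity)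
  obtain ⟨q, hq⟩ := hφ i j hij.le
  refine ⟨q, (div_le_iff₀' hK).2 (large hij hq), fun w hw => (almost_fixed hq).trans ?_⟩
  rw [← le_div_iff₀' hK, ← dist_eq_norm]
  exact hV ⟨w, hw⟩

end Cocycle

section StrongOperatorTopology

variable {𝕜 : Type*} [RCLike 𝕜] {X : Type*} [NormedAddCommGroup X] [NormedSpace 𝕜 X]

theorem continuous_sot_apply (x : X) : Continuous fun A : X →Lₚₜ[𝕜] X => toSOT.symm A x :=
  continuous_eval_const (F := X →Lₚₜ[𝕜] X) x

theorem continuous_sot_mul_right (R : X →L[𝕜] X) :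
    Continuous fun A : X →Lₚₜ[𝕜] X => toSOT (toSOT.symm A * R) :=
  PointwiseConvergenceCLM.continuous_of_continuous_eval fun x => continuous_sot_apply (R x)

theorem continuous_sot_mul_left (R : X →L[𝕜] X) :
    Continuous fun A : X →Lₚₜ[𝕜] X => toSOT (R * toSOT.symm A) :=
  PointwiseConvergenceCLM.continuous_of_continuous_eval fun x =>
    R.continuous.comp (continuous_sot_apply x)

theorem continuousOn_sot_mul {G : Set (X →L[𝕜] X)} {M : ℝ} (hM : ∀ A ∈ G, ‖A‖ ≤ M) :
    ContinuousOn (fun p : (X →Lₚₜ[𝕜] X) × (X →Lₚₜ[𝕜] X) => toSOT (toSOT.symm p.1 * toSOT.symm p.2))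
      ((toSOT '' G) ×ˢ Set.univ) := by
  rintro ⟨A, B⟩ -
  refine PointwiseConvergenceCLM.tendsto_iff_forall_tendsto.2 fun x => ?_
  set l := 𝓝[(toSOT '' G) ×ˢ Set.univ] (A, B)
  have tendsto_fst : Tendsto (fun p : (X →Lₚₜ[𝕜] X) × (X →Lₚₜ[𝕜] X) => p.1 (B x)) l (𝓝 (A (B x))) :=
    ((continuous_sot_apply (B x)).comp continuous_fst).continuousWithinAt
  have tendsto_snd : Tendsto (fun p : (X →Lₚₜ[𝕜] X) × (X →Lₚₜ[𝕜] X) => p.2 x) l (𝓝 (B x)) :=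
    ((continuous_sot_apply x).comp continuous_snd).continuousWithinAt
  have tendsto_diff :
      Tendsto (fun p : (X →Lₚₜ[𝕜] X) × (X →Lₚₜ[𝕜] X) => p.1 (p.2 x - B x)) l (𝓝 0) := by
    refine squeeze_zero_norm' (a := fun p => M * ‖p.2 x - B x‖) ?_
      (by simpa using (tendsto_snd.sub_const (B x)).norm.const_mul M)
    filter_upwards [self_mem_nhdsWithin] with p ⟨⟨C, hC, hCp⟩, _⟩
    rw [← hCp]
    exact C.le_of_opNorm_le (hM C hC) _
  simpa only [map_sub, sub_add_cancel, zero_add] using! tendsto_diff.add tendsto_fst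

theorem continuousOn_sot_inverse {G : Set (X →L[𝕜] X)} {M : ℝ} (hG : ∀ A ∈ G, IsUnit A)
    (hM : ∀ A ∈ G, ‖Ring.inverse A‖ ≤ M) :
    ContinuousOn (fun A : X →Lₚₜ[𝕜] X => toSOT (Ring.inverse (toSOT.symm A))) (toSOT '' G) := by
  rintro _ ⟨A, hA, rfl⟩
  refine PointwiseConvergenceCLM.tendsto_iff_forall_tendsto.2 fun x => ?_
  set y := Ring.inverse A x
  have hAy : A y = x := DFunLike.congr_fun (Ring.mul_inverse_cancel A (hG A hA)) x
  have tendsto_apply : Tendsto (fun B : X →Lₚₜ[𝕜] X => B y) (𝓝[toSOT '' G] (toSOT A)) (𝓝 (A y)) :=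
    (continuous_sot_apply y).continuousWithinAt
  rw [tendsto_iff_norm_sub_tendsto_zero]
  refine squeeze_zero' (g := fun B : X →Lₚₜ[𝕜] X => M * ‖B y - A y‖)
    (Eventually.of_forall fun _ => norm_nonneg _) ?_
    (by simpa using (tendsto_apply.sub_const (A y)).norm.const_mul M)
  filter_upwards [self_mem_nhdsWithin]
  rintro _ ⟨B, hB, rfl⟩
  have hBy : Ring.inverse B (B y) = y :=
    DFunLike.congr_fun (Ring.inverse_mul_cancel B (hG B hB)) y
  calc ‖Ring.inverse B x - y‖ = ‖Ring.inverse B (B y - A y)‖ := by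
        rw [map_sub, hBy, hAy, norm_sub_rev]
    _ ≤ M * ‖B y - A y‖ := (Ring.inverse B).le_of_opNorm_le (hM B hB) _

theorem isCompactOperatorGroup_of_isCompact {G : Set (X →L[𝕜] X)} {M : ℝ} (hM : ∀ A ∈ G, ‖A‖ ≤ M)
    (hone : 1 ∈ G) (hmul : ∀ A ∈ G, ∀ B ∈ G, A * B ∈ G)
    (hinv : ∀ A ∈ G, ∃ B ∈ G, A * B = 1 ∧ B * A = 1) (hG : IsCompact (toSOT '' G)) :
    IsCompactOperatorGroup G where
  one_mem := hone
  mul_mem := hmul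
  exists_inv := hinv
  isCompact := hG
  continuousOn_mul := (continuousOn_sot_mul hM).mono (Set.prod_mono_right (Set.subset_univ _))
  continuousOn_inv := by
    refine continuousOn_sot_inverse (M := M) (fun A hA => ?_) (fun A hA => ?_)
    · obtain ⟨B, -, hAB, hBA⟩ := hinv A hA
      exact ⟨⟨A, B, hAB, hBA⟩, rfl⟩
    · obtain ⟨B, hB, hAB, hBA⟩ := hinv A hA
      have hinverse : Ring.inverse A = B := Ring.inverse_unit (⟨A, B, hAB, hBA⟩ : (X →L[𝕜] X)ˣ)
      exact hinverse ▸ hM B hB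

variable {𝒯 : Set (X →L[𝕜] X)}

theorem subset_sotClosure : 𝒯 ⊆ sotClosure 𝒯 :=
  Set.image_subset_iff.1 subset_closure

theorem sotClosure_induction {p : (X →L[𝕜] X) → Prop}
    (hp : IsClosed {A : X →Lₚₜ[𝕜] X | p (toSOT.symm A)}) (h : ∀ A ∈ 𝒯, p A)
    {A : X →L[𝕜] X} (hA : A ∈ sotClosure 𝒯) : p A :=
  have hsub : toSOT '' 𝒯 ⊆ {A : X →Lₚₜ[𝕜] X | p (toSOT.symm A)} := Set.image_subset_iff.2 h
  closure_minimal hsub hp hA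

theorem norm_le_of_mem_sotClosure {M : ℝ} (hM : ∀ A ∈ 𝒯, ‖A‖ ≤ M) {A : X →L[𝕜] X}
    (hA : A ∈ sotClosure 𝒯) : ‖A‖ ≤ M := by
  have hM0 : 0 ≤ M := sotClosure_induction (p := fun _ => 0 ≤ M) isClosed_const
    (fun A hA => (norm_nonneg A).trans (hM A hA)) hA
  have isClosed_norm_le (x : X) : IsClosed {A : X →Lₚₜ[𝕜] X | ‖toSOT.symm A x‖ ≤ M * ‖x‖} :=
    isClosed_le (continuous_sot_apply x).norm continuous_const
  exact A.opNorm_le_bound hM0 fun x => sotClosure_induction (p := fun A => ‖A x‖ ≤ M * ‖x‖)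
    (isClosed_norm_le x) (fun A hA => A.le_of_opNorm_le (hM A hA) x) hA

theorem commute_of_mem_sotClosure (hcomm : ∀ A ∈ 𝒯, ∀ B ∈ 𝒯, Commute A B) {A B : X →L[𝕜] X}
    (hA : A ∈ sotClosure 𝒯) (hB : B ∈ sotClosure 𝒯) : Commute A B := by
  have isClosed_commute (C : X →L[𝕜] X) :
      IsClosed {A : X →Lₚₜ[𝕜] X | toSOT.symm A * C = C * toSOT.symm A} := by
    simpa only [toSOT.apply_eq_iff_eq] using
      isClosed_eq (continuous_sot_mul_right C) (continuous_sot_mul_left C)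
  refine sotClosure_induction (p := fun A => A * B = B * A) (isClosed_commute B)
    (fun A hA => ?_) hA
  exact (sotClosure_induction (p := fun B => B * A = A * B) (isClosed_commute A)
    (fun B hB => hcomm B hB A hA) hB).symm

theorem mul_mem_sotClosure (hmul : ∀ A ∈ 𝒯, ∀ B ∈ 𝒯, A * B ∈ 𝒯) {A B : X →L[𝕜] X}
    (hA : A ∈ sotClosure 𝒯) (hB : B ∈ sotClosure 𝒯) : A * B ∈ sotClosure 𝒯 := by
  refine sotClosure_induction (p := fun A => A * B ∈ sotClosure 𝒯)
    (isClosed_closure.preimage (continuous_sot_mul_right B)) (fun A hA => ?_) hA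
  exact sotClosure_induction (p := fun B => A * B ∈ sotClosure 𝒯)
    (isClosed_closure.preimage (continuous_sot_mul_left A))
    (fun B hB => subset_sotClosure (hmul A hA B hB)) hB

theorem isCompact_sotClosure {M : ℝ} (hM : ∀ A ∈ 𝒯, ‖A‖ ≤ M)
    (horb : ∀ x, RelCompact ((fun A : X →L[𝕜] X => A x) '' 𝒯)) :
    IsCompact (toSOT '' sotClosure 𝒯) := by
  have hemb := PointwiseConvergenceCLM.isEmbedding_coeFn (RingHom.id 𝕜) X X
  rw [sotClosure, Set.image_preimage_eq _ toSOT.surjective, hemb.isCompact_iff,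
    hemb.closure_eq_preimage_closure_image, Set.image_preimage_eq_of_subset, Set.image_image]
  · refine (isCompact_univ_pi horb).closure_of_subset ?_
    rintro _ ⟨A, hA, rfl⟩ x -
    exact subset_closure ⟨A, hA, rfl⟩
  · intro f hf
    rw [Set.image_image] at hf
    exact ⟨toSOT (ContinuousLinearMap.ofMemClosureImageCoeBounded f
      (isBounded_iff_forall_norm_le.2 ⟨M, hM⟩) hf), rfl⟩

end StrongOperatorTopology

section Restriction

variable {𝕜 : Type*} [RCLike 𝕜] {X : Type*} [NormedAddCommGroup X] [NormedSpace 𝕜 X]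
  {𝒯 : Set (X →L[𝕜] X)} {F : Submodule 𝕜 X}

theorem norm_le_of_mem_restrictTo {M : ℝ} (hM : ∀ A ∈ 𝒯, ‖A‖ ≤ M) {B : F →L[𝕜] F}
    (hB : B ∈ restrictTo 𝒯 F) : ‖B‖ ≤ M := by
  obtain ⟨A, hA, hBA⟩ := hB
  refine B.opNorm_le_bound ((norm_nonneg A).trans (hM A hA)) fun y => ?_
  calc ‖B y‖ = ‖A y‖ := congrArg norm (hBA y)
    _ ≤ M * ‖y‖ := A.le_of_opNorm_le (hM A hA) y

theorem mul_mem_restrictTo (hmul : ∀ A ∈ 𝒯, ∀ B ∈ 𝒯, A * B ∈ 𝒯) {A B : F →L[𝕜] F}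
    (hA : A ∈ restrictTo 𝒯 F) (hB : B ∈ restrictTo 𝒯 F) : A * B ∈ restrictTo 𝒯 F := by
  obtain ⟨R, hR, hAR⟩ := hA
  obtain ⟨Q, hQ, hBQ⟩ := hB
  exact ⟨R * Q, hmul R hR Q hQ, fun y => by simp [hAR, hBQ]⟩

theorem commute_of_mem_restrictTo (hcomm : ∀ A ∈ 𝒯, ∀ B ∈ 𝒯, Commute A B) {A B : F →L[𝕜] F}
    (hA : A ∈ restrictTo 𝒯 F) (hB : B ∈ restrictTo 𝒯 F) : Commute A B := by
  obtain ⟨R, hR, hAR⟩ := hA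
  obtain ⟨Q, hQ, hBQ⟩ := hB
  ext y
  simpa [hAR, hBQ] using DFunLike.congr_fun (hcomm R hR Q hQ).eq (y : X)

theorem isCompact_restrictTo (h𝒯 : IsCompact (toSOT '' 𝒯)) (hF : ∀ A ∈ 𝒯, ∀ y ∈ F, A y ∈ F) :
    IsCompact (toSOT '' restrictTo 𝒯 F) := by
  have : CompactSpace (toSOT '' 𝒯) := isCompact_iff_compactSpace.1 h𝒯
  have maps (A : toSOT '' 𝒯) : ∀ y ∈ F, toSOT.symm A.1 y ∈ F := by
    obtain ⟨_, A, hA, rfl⟩ := A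
    exact hF A hA
  let r : toSOT '' 𝒯 → (F →Lₚₜ[𝕜] F) := fun A => toSOT ((toSOT.symm A.1).restrict (maps A))
  have hr : Continuous r := PointwiseConvergenceCLM.continuous_of_continuous_eval fun y =>
    ((continuous_sot_apply (y : X)).comp continuous_subtype_val).subtype_mk _
  convert isCompact_range hr using 1
  ext B
  constructor
  · rintro ⟨B, ⟨A, hA, hBA⟩, rfl⟩
    refine ⟨⟨toSOT A, A, hA, rfl⟩, ?_⟩
    ext y
    exact (hBA y).symm
  · rintro ⟨⟨_, A, hA, rfl⟩, rfl⟩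
    exact ⟨_, ⟨A, hA, fun y => rfl⟩, rfl⟩

end Restriction

section JacobsDeLeeuwGlicksberg

theorem exists_idempotent_forall_exists_mul_eq {Y : Type*} [Semigroup Y] [TopologicalSpace Y]
    [T2Space Y] (hcont : ∀ r : Y, Continuous (· * r)) {G : Set Y} (hG : IsCompact G)
    (hne : G.Nonempty) (hmul : ∀ g ∈ G, ∀ h ∈ G, g * h ∈ G)
    (hcomm : ∀ g ∈ G, ∀ h ∈ G, g * h = h * g) :
    ∃ e ∈ G, e * e = e ∧ ∀ g ∈ G, ∃ h ∈ G, g * h = e := by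
  have : Nonempty G := hne.to_subtype
  obtain ⟨g₀, hg₀⟩ := hne
  let I : G → Set Y := fun g => (· * (g : Y)) '' G
  have isCompact_I (g : G) : IsCompact (I g) := hG.image (hcont g)
  have I_subset (g : G) : I g ⊆ G := Set.image_subset_iff.2 fun k hk => hmul k hk g g.2
  have directed_I : Directed (· ⊇ ·) I := fun ⟨g, hg⟩ ⟨h, hh⟩ => by
    refine ⟨⟨g * h, hmul g hg h hh⟩, ?_, ?_⟩
    · rintro _ ⟨k, hk, rfl⟩
      exact ⟨k * h, hmul k hk h hh, by simp only [mul_assoc, hcomm g hg h hh]⟩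
    · rintro _ ⟨k, hk, rfl⟩
      exact ⟨k * g, hmul k hk g hg, mul_assoc _ _ _⟩
  -- The idempotent is found in the intersection of all ideals, which is the minimal ideal of `G`.
  have nonempty_iInter : (⋂ g, I g).Nonempty :=
    IsCompact.nonempty_iInter_of_directed_nonempty_isCompact_isClosed I directed_I
      (fun _ => ⟨_, g₀, hg₀, rfl⟩) isCompact_I fun g => (isCompact_I g).isClosed
  have iInter_subset : ⋂ g, I g ⊆ G := (Set.iInter_subset I ⟨g₀, hg₀⟩).trans (I_subset _)
  have isCompact_iInter : IsCompact (⋂ g, I g) :=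
    hG.of_isClosed_subset (isClosed_iInter fun g => (isCompact_I g).isClosed) iInter_subset
  have mul_mem_iInter : ∀ k ∈ ⋂ g, I g, ∀ l ∈ ⋂ g, I g, k * l ∈ ⋂ g, I g := fun k hk l hl => by
    refine Set.mem_iInter.2 fun g => ?_
    obtain ⟨h, hh, rfl⟩ := Set.mem_iInter.1 hl g
    exact ⟨k * h, hmul k (iInter_subset hk) h hh, mul_assoc _ _ _⟩
  obtain ⟨e, he, hee⟩ := exists_idempotent_in_compact_subsemigroup hcont _ nonempty_iInter
    isCompact_iInter mul_mem_iInter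
  refine ⟨e, iInter_subset he, hee, fun g hg => ?_⟩
  obtain ⟨h, hh, hhg⟩ := Set.mem_iInter.1 he ⟨g, hg⟩
  exact ⟨h, hh, (hcomm g hg h hh).trans hhg⟩

variable {𝕜 : Type*} [RCLike 𝕜] {X : Type*} [NormedAddCommGroup X] [NormedSpace 𝕜 X]

theorem exists_isIdempotentElem_forall_exists_mul_eq {G : Set (X →L[𝕜] X)}
    (hG : IsCompact (toSOT '' G)) (hne : G.Nonempty) (hmul : ∀ A ∈ G, ∀ B ∈ G, A * B ∈ G)
    (hcomm : ∀ A ∈ G, ∀ B ∈ G, Commute A B) :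
    ∃ P ∈ G, IsIdempotentElem P ∧ ∀ A ∈ G, ∃ B ∈ G, A * B = P := by
  let _ : Semigroup (X →Lₚₜ[𝕜] X) :=
    { mul := fun A B => toSOT (toSOT.symm A * toSOT.symm B)
      mul_assoc := fun _ _ _ => rfl }
  have toSOT_mul (A B : X →L[𝕜] X) : toSOT A * toSOT B = toSOT (A * B) := rfl
  obtain ⟨_, ⟨P, hP, rfl⟩, hPP, hPG⟩ := exists_idempotent_forall_exists_mul_eq
    (fun R => continuous_sot_mul_right (toSOT.symm R)) hG (hne.image toSOT)
    (by simpa only [Set.forall_mem_image, toSOT_mul, toSOT.injective.mem_set_image] using hmul)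
    (by simpa only [Set.forall_mem_image, toSOT_mul, toSOT.apply_eq_iff_eq, commute_iff_eq]
      using hcomm)
  refine ⟨P, hP, toSOT.injective hPP, fun A hA => ?_⟩
  obtain ⟨_, ⟨B, hB, rfl⟩, hAB⟩ := hPG _ ⟨A, hA, rfl⟩
  exact ⟨B, hB, toSOT.injective hAB⟩

theorem apply_mem_range_of_commute {P A : X →L[𝕜] X} (h : Commute A P) :
    ∀ y ∈ LinearMap.range (P : X →ₗ[𝕜] X), A y ∈ LinearMap.range (P : X →ₗ[𝕜] X) := by
  rintro _ ⟨z, rfl⟩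
  exact ⟨A z, (DFunLike.congr_fun h.eq z).symm⟩

theorem isCompactOperatorGroup_restrictTo_range {G : Set (X →L[𝕜] X)} {M : ℝ}
    (hM : ∀ A ∈ G, ‖A‖ ≤ M) (hmul : ∀ A ∈ G, ∀ B ∈ G, A * B ∈ G)
    (hcomm : ∀ A ∈ G, ∀ B ∈ G, Commute A B) (hG : IsCompact (toSOT '' G)) {P : X →L[𝕜] X}
    (hP : P ∈ G) (hPP : IsIdempotentElem P) (hPG : ∀ A ∈ G, ∃ B ∈ G, A * B = P) :
    IsCompactOperatorGroup (restrictTo G (LinearMap.range (P : X →ₗ[𝕜] X))) := by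
  have maps (A) (hA : A ∈ G) := apply_mem_range_of_commute (hcomm A hA P hP)
  have P_apply (y : LinearMap.range (P : X →ₗ[𝕜] X)) : P y = y :=
    LinearMap.IsIdempotentElem.mem_range_iff
      (ContinuousLinearMap.isIdempotentElem_toLinearMap_iff.2 hPP) |>.1 y.2
  refine isCompactOperatorGroup_of_isCompact (fun _ => norm_le_of_mem_restrictTo hM)
    ⟨P, hP, fun y => (P_apply y).symm⟩ (fun _ hA _ hB => mul_mem_restrictTo hmul hA hB) ?_
    (isCompact_restrictTo hG maps)
  rintro A ⟨R, hR, hAR⟩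
  obtain ⟨Q, hQ, hRQ⟩ := hPG R hR
  have hQ' : Q.restrict (maps Q hQ) ∈ restrictTo G (LinearMap.range (P : X →ₗ[𝕜] X)) :=
    ⟨Q, hQ, fun _ => rfl⟩
  have mul_eq_one : A * Q.restrict (maps Q hQ) = 1 := by
    ext y
    exact (hAR _).trans ((DFunLike.congr_fun hRQ (y : X)).trans (P_apply y))
  refine ⟨_, hQ', mul_eq_one, ?_⟩
  rw [← mul_eq_one]
  exact commute_of_mem_restrictTo hcomm hQ' ⟨R, hR, hAR⟩

variable {𝒯 : Set (X →L[𝕜] X)} {P Q : X →L[𝕜] X}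

theorem IsJdLGProjection.exists_restrict_inv (hP : IsJdLGProjection 𝒯 P)
    (hcomm : ∀ A ∈ 𝒯, ∀ B ∈ 𝒯, Commute A B) {A : X →L[𝕜] X} (hA : A ∈ sotClosure 𝒯) :
    ∃ B ∈ sotClosure 𝒯, ∀ y ∈ LinearMap.range (P : X →ₗ[𝕜] X), B (A y) = y := by
  have maps := apply_mem_range_of_commute (commute_of_mem_sotClosure hcomm hA hP.mem_sotClosure)
  obtain ⟨_, ⟨B, hB, hCB⟩, -, hCA⟩ := hP.group_on_range.exists_inv (A.restrict maps)
    ⟨A, hA, fun _ => rfl⟩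
  refine ⟨B, hB, fun y hy => ?_⟩
  calc B (A y) = _ := (hCB ⟨A y, maps y hy⟩).symm
    _ = y := congrArg Subtype.val (DFunLike.congr_fun hCA ⟨y, hy⟩)

theorem IsJdLGProjection.norm_le (hP : IsJdLGProjection 𝒯 P)
    (hcomm : ∀ A ∈ 𝒯, ∀ B ∈ 𝒯, Commute A B) {M : ℝ} (hM : ∀ A ∈ 𝒯, ‖A‖ ≤ M) {A : X →L[𝕜] X}
    (hA : A ∈ 𝒯) {y : X} (hy : y ∈ LinearMap.range (P : X →ₗ[𝕜] X)) : ‖y‖ ≤ M * ‖A y‖ := by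
  obtain ⟨B, hB, hBA⟩ := hP.exists_restrict_inv hcomm (subset_sotClosure hA)
  calc ‖y‖ = ‖B (A y)‖ := by rw [hBA y hy]
    _ ≤ M * ‖A y‖ := B.le_of_opNorm_le (norm_le_of_mem_sotClosure hM hB) _

theorem IsJdLGProjection.mul_eq_right (hP : IsJdLGProjection 𝒯 P) (hQ : IsJdLGProjection 𝒯 Q)
    (hcomm : ∀ A ∈ 𝒯, ∀ B ∈ 𝒯, Commute A B) : Q * P = P := by
  have maps := apply_mem_range_of_commute
    (commute_of_mem_sotClosure hcomm hQ.mem_sotClosure hP.mem_sotClosure)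
  obtain ⟨B, -, hBQ⟩ := hP.exists_restrict_inv hcomm hQ.mem_sotClosure
  ext x
  have hPx : P x ∈ LinearMap.range (P : X →ₗ[𝕜] X) := ⟨x, rfl⟩
  calc Q (P x) = B (Q (Q (P x))) := (hBQ _ (maps _ hPx)).symm
    _ = B (Q (P x)) := congrArg B (DFunLike.congr_fun hQ.isIdempotentElem.eq (P x))
    _ = P x := hBQ _ hPx

theorem IsJdLGProjection.unique (hP : IsJdLGProjection 𝒯 P) (hQ : IsJdLGProjection 𝒯 Q)
    (hcomm : ∀ A ∈ 𝒯, ∀ B ∈ 𝒯, Commute A B) : P = Q := by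
  rw [← hP.mul_eq_right hQ hcomm,
    (commute_of_mem_sotClosure hcomm hQ.mem_sotClosure hP.mem_sotClosure).eq,
    hQ.mul_eq_right hP hcomm]

theorem existsUnique_isJdLGProjection (hne : 𝒯.Nonempty)
    (hmul : ∀ A ∈ 𝒯, ∀ B ∈ 𝒯, A * B ∈ 𝒯) (hcomm : ∀ A ∈ 𝒯, ∀ B ∈ 𝒯, Commute A B) {M : ℝ}
    (hM : ∀ A ∈ 𝒯, ‖A‖ ≤ M) (horb : ∀ x, RelCompact ((fun A : X →L[𝕜] X => A x) '' 𝒯)) :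
    ∃! P, IsJdLGProjection 𝒯 P := by
  have isCompact_G := isCompact_sotClosure hM horb
  have mul_G : ∀ A ∈ sotClosure 𝒯, ∀ B ∈ sotClosure 𝒯, A * B ∈ sotClosure 𝒯 :=
    fun _ hA _ hB => mul_mem_sotClosure hmul hA hB
  have commute_G : ∀ A ∈ sotClosure 𝒯, ∀ B ∈ sotClosure 𝒯, Commute A B :=
    fun _ hA _ hB => commute_of_mem_sotClosure hcomm hA hB
  obtain ⟨P, hP, hPP, hPG⟩ := exists_isIdempotentElem_forall_exists_mul_eq isCompact_G
    (hne.mono subset_sotClosure) mul_G commute_G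
  have isJdLG_P : IsJdLGProjection 𝒯 P :=
    { mem_sotClosure := hP
      isIdempotentElem := hPP
      group_on_range := isCompactOperatorGroup_restrictTo_range
        (fun _ => norm_le_of_mem_sotClosure hM) mul_G commute_G isCompact_G hP hPP hPG
      zero_on_ker := ⟨P, hP, fun y => (LinearMap.mem_ker.1 y.2).symm⟩ }
  exact ⟨P, isJdLG_P, fun Q hQ => hQ.unique isJdLG_P hcomm⟩

end JacobsDeLeeuwGlicksberg

section FinitelyGenerated

theorem wellQuasiOrdered_dvd {N : Type*} [CommMonoid N] [Monoid.FG N] :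
    WellQuasiOrdered fun g h : N => g ∣ h := by
  obtain ⟨s, hs, hfin⟩ := Monoid.fg_iff.1 ‹Monoid.FG N›
  have : Fintype s := hfin.fintype
  let f : (fun n k : s → ℕ => n ≤ k) →r fun g h : N => g ∣ h :=
    { toFun := fun n => ∏ a : s, (a : N) ^ n a
      map_rel' := fun hnk => Finset.prod_dvd_prod_of_dvd _ _ fun a _ => pow_dvd_pow _ (hnk a) }
  refine wellQuasiOrdered_le.of_surjective f fun g => ?_
  obtain ⟨n, hn⟩ := Submonoid.mem_closure_iff_of_fintype.1 (hs ▸ Submonoid.mem_top g)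
  exact ⟨n, hn.symm⟩

theorem exists_norm_map_le_of_mem_closure {N A : Type*} [CommMonoid N] [SeminormedRing A]
    (f : N →* A) {s : Set N} (hs : s.Finite) (h : ∀ a ∈ s, ∃ C : ℝ, ∀ n : ℕ, ‖f a ^ n‖ ≤ C) :
    ∃ M : ℝ, ∀ g ∈ Submonoid.closure s, ‖f g‖ ≤ M := by
  induction s, hs using Set.Finite.induction_on with
  | empty => exact ⟨‖f 1‖, by simp⟩
  | @insert a s _ _ ih =>
    obtain ⟨C, hC⟩ := h a (Set.mem_insert a s)
    obtain ⟨M, hM⟩ := ih fun b hb => h b (Set.mem_insert_of_mem a hb)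
    refine ⟨C * M, fun g hg => ?_⟩
    rw [Set.insert_eq, Submonoid.closure_union, Submonoid.mem_sup] at hg
    obtain ⟨_, hp, z, hz, rfl⟩ := hg
    obtain ⟨n, rfl⟩ := Submonoid.mem_closure_singleton.1 hp
    rw [map_mul, map_pow]
    exact norm_mul_le_of_le (hC n) (hM z hz)

variable {𝕜 : Type*} [RCLike 𝕜] {E : Type*} [NormedAddCommGroup E] [NormedSpace 𝕜 E] {m : ℕ}
  {T : Fin m → E →L[𝕜] E}

theorem closure_generatedSemigroup :
    Submonoid.closure (generatedSemigroup T : Set (E →L[𝕜] E)) = Submonoid.closure (Set.range T) :=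
  SetLike.coe_injective <| by
    simp only [Submonoid.closure_eq_one_union, Subsemigroup.closure_eq, generatedSemigroup]

theorem isMulCommutative_closure_range (hcomm : ∀ i j, Commute (T i) (T j)) :
    IsMulCommutative (Submonoid.closure (Set.range T)) :=
  Submonoid.isMulCommutative_closure _ <| by
    rintro _ ⟨i, rfl⟩ _ ⟨j, rfl⟩
    exact hcomm i j

theorem generatedSemigroup_le_closure :
    ∀ R ∈ generatedSemigroup T, R ∈ Submonoid.closure (Set.range T) :=
  closure_generatedSemigroup (T := T) ▸ Submonoid.subset_closure

theorem commute_of_mem_generatedSemigroup (hcomm : ∀ i j, Commute (T i) (T j)) :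
    ∀ A ∈ generatedSemigroup T, ∀ B ∈ generatedSemigroup T, Commute A B := by
  have := isMulCommutative_closure_range hcomm
  exact fun A hA B hB => setLike_mul_comm (generatedSemigroup_le_closure A hA)
    (generatedSemigroup_le_closure B hB)

open scoped IsMulCommutative in
theorem exists_norm_le_of_mem_generatedSemigroup (hcomm : ∀ i j, Commute (T i) (T j))
    (hpb : ∀ j, IsPowerBounded (T j)) : ∃ M : ℝ, ∀ R ∈ generatedSemigroup T, ‖R‖ ≤ M := by
  have := isMulCommutative_closure_range hcomm
  let N := Submonoid.closure (Set.range T)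
  obtain ⟨M, hM⟩ := exists_norm_map_le_of_mem_closure N.subtype
    ((Set.finite_range T).preimage Subtype.val_injective.injOn) <| by
      rintro ⟨_, -⟩ ⟨j, rfl⟩
      exact hpb j
  refine ⟨M, fun R hR => hM ⟨R, generatedSemigroup_le_closure R hR⟩ ?_⟩
  rw [Submonoid.closure_closure_coe_preimage]
  exact Submonoid.mem_top _

open scoped IsMulCommutative in
theorem wellQuasiOrdered_dvd_closure_generatedSemigroup (hcomm : ∀ i j, Commute (T i) (T j)) :
    WellQuasiOrdered
      fun A B : Submonoid.closure (generatedSemigroup T : Set (E →L[𝕜] E)) => A ∣ B := by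
  rw [closure_generatedSemigroup]
  have := isMulCommutative_closure_range hcomm
  exact wellQuasiOrdered_dvd

theorem forall_mem_generatedSemigroup_relCompact_orbit_sub_iff {x : E} :
    (∀ R ∈ generatedSemigroup T, RelCompact (orbit (generatedSemigroup T) (x - R x))) ↔
      ∀ j, RelCompact (orbit (generatedSemigroup T) (x - T j x)) :=
  ⟨fun h j => h (T j) (Subsemigroup.subset_closure ⟨j, rfl⟩),
    fun h _ hR => mem_aap.1 (sub_apply_mem_aap h hR)⟩

end FinitelyGenerated

section AlmostPeriodic

theorem totallyBounded_of_forall_exists_dist_lt {α : Type*} [PseudoMetricSpace α] {A : Set α}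
    (h : ∀ ε > 0, ∃ B, TotallyBounded B ∧ ∀ a ∈ A, ∃ b ∈ B, dist a b < ε) : TotallyBounded A := by
  refine Metric.totallyBounded_iff.2 fun ε hε => ?_
  obtain ⟨B, hB, hAB⟩ := h (ε / 2) (half_pos hε)
  obtain ⟨t, ht, hBt⟩ := Metric.totallyBounded_iff.1 hB (ε / 2) (half_pos hε)
  refine ⟨t, ht, fun a ha => ?_⟩
  obtain ⟨b, hb, hab⟩ := hAB a ha
  obtain ⟨z, hz, hbz⟩ := Set.mem_iUnion₂.1 (hBt hb)
  exact Set.mem_iUnion₂.2 ⟨z, hz, (dist_triangle a b z).trans_lt (by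
    linarith [Metric.mem_ball.1 hbz])⟩

theorem RelCompact.of_subset_image {α β : Type*} [TopologicalSpace α] [TopologicalSpace β]
    [R1Space β] {A : Set α} {B : Set β} {f : α → β} (hA : RelCompact A) (hf : Continuous f)
    (h : B ⊆ f '' A) : RelCompact B :=
  (hA.image hf).closure_of_subset (h.trans (Set.image_mono subset_closure))

variable {𝕜 : Type*} [RCLike 𝕜] {E : Type*} [NormedAddCommGroup E] [NormedSpace 𝕜 E]
  {S : Subsemigroup (E →L[𝕜] E)} {M : ℝ} {P : aap S →L[𝕜] aap S} {x : E}

theorem relCompact_iff_totallyBounded [CompleteSpace E] {A : Set E} :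
    RelCompact A ↔ TotallyBounded A :=
  ⟨fun h => h.totallyBounded.subset subset_closure,
    fun h => h.closure.isCompact_of_isClosed isClosed_closure⟩

theorem isClosed_aap [CompleteSpace E] (hM : ∀ R ∈ S, ‖R‖ ≤ M) : IsClosed (aap S : Set E) := by
  refine isClosed_of_closure_subset fun x hx => relCompact_iff_totallyBounded.2 <|
    totallyBounded_of_forall_exists_dist_lt fun ε hε => ?_
  have hK : 0 < max M 1 := lt_max_of_lt_right one_pos
  obtain ⟨y, hy, hxy⟩ := Metric.mem_closure_iff.1 hx (ε / max M 1) (by positivity)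
  refine ⟨orbit S y, relCompact_iff_totallyBounded.1 hy, ?_⟩
  rintro _ ⟨R, hR, rfl⟩
  refine ⟨R y, ⟨R, hR, rfl⟩, ?_⟩
  calc dist (R x) (R y) ≤ max M 1 * dist x y := by
        rw [dist_eq_norm, dist_eq_norm, ← map_sub]
        exact R.le_of_opNorm_le ((hM R hR).trans (le_max_left M 1)) _
    _ < ε := (lt_div_iff₀' hK).1 hxy

theorem relCompact_image_restrictTo_aap [CompleteSpace E] (hM : ∀ R ∈ S, ‖R‖ ≤ M) (y : aap S) :
    RelCompact
      ((fun A : aap S →L[𝕜] aap S => A y) '' restrictTo (S : Set (E →L[𝕜] E)) (aap S)) := by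
  have hK : IsCompact ((↑) ⁻¹' closure (orbit S (y : E)) : Set (aap S)) :=
    (isClosed_aap hM).isClosedEmbedding_subtypeVal.isCompact_preimage y.2
  refine hK.closure_of_subset ?_
  rintro _ ⟨A, ⟨R, hR, hAR⟩, rfl⟩
  exact subset_closure ⟨R, hR, (hAR y).symm⟩

theorem existsUnique_isAapProjection [CompleteSpace E] (hne : (S : Set (E →L[𝕜] E)).Nonempty)
    (hcomm : ∀ A ∈ S, ∀ B ∈ S, Commute A B) (hM : ∀ R ∈ S, ‖R‖ ≤ M) :
    ∃! P, IsAapProjection S P := by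
  have hne' : (restrictTo (S : Set (E →L[𝕜] E)) (aap S)).Nonempty :=
    hne.elim fun _ hR => (exists_restrictTo_aap hR).imp fun _ h => h.1
  exact existsUnique_isJdLGProjection hne'
    (fun _ hA _ hB => mul_mem_restrictTo (fun _ hR _ hQ => S.mul_mem hR hQ) hA hB)
    (fun _ hA _ hB => commute_of_mem_restrictTo hcomm hA hB)
    (fun _ hA => norm_le_of_mem_restrictTo hM hA) (relCompact_image_restrictTo_aap hM)

theorem apply_mem_aap_of_mem_closure {g : E →L[𝕜] E}
    (hg : g ∈ Submonoid.closure (S : Set (E →L[𝕜] E))) : ∀ y ∈ aap S, g y ∈ aap S := by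
  induction hg using Submonoid.closure_induction with
  | mem R hR => exact fun y hy => apply_mem_aap hR hy
  | one => exact fun y hy => hy
  | mul _ _ _ _ ihg ihh => exact fun y hy => ihg _ (ihh y hy)

variable (S) in
/-- The action on `E_aap` of the monoid generated by `S`, that is of `S ∪ {1}`. -/
def aapAction : Submonoid.closure (S : Set (E →L[𝕜] E)) →* (aap S →L[𝕜] aap S) where
  toFun g := (g : E →L[𝕜] E).restrict (apply_mem_aap_of_mem_closure g.2)
  map_one' := rfl
  map_mul' _ _ := rfl

theorem eq_one_or_mem_of_mem_closure {N : Type*} [Monoid N] {S : Subsemigroup N} {g : N}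
    (hg : g ∈ Submonoid.closure (S : Set N)) : g = 1 ∨ g ∈ S := by
  rwa [← SetLike.mem_coe, Submonoid.closure_eq_one_union, Subsemigroup.closure_eq] at hg

theorem norm_le_of_mem_closure (hM : ∀ R ∈ S, ‖R‖ ≤ M) {g : E →L[𝕜] E}
    (hg : g ∈ Submonoid.closure (S : Set (E →L[𝕜] E))) : ‖g‖ ≤ max M 1 := by
  rcases eq_one_or_mem_of_mem_closure hg with rfl | hg
  · exact ContinuousLinearMap.norm_id_le.trans (le_max_right M 1)
  · exact (hM g hg).trans (le_max_left M 1)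

theorem norm_aapAction_le (hM : ∀ R ∈ S, ‖R‖ ≤ M) (g : Submonoid.closure (S : Set (E →L[𝕜] E))) :
    ‖aapAction S g‖ ≤ max M 1 :=
  norm_le_of_mem_restrictTo (fun _ hR => norm_le_of_mem_closure hM hR) ⟨g, g.2, fun _ => rfl⟩

theorem aapAction_eq_one_or_mem (g : Submonoid.closure (S : Set (E →L[𝕜] E))) :
    aapAction S g = 1 ∨ aapAction S g ∈ restrictTo (S : Set (E →L[𝕜] E)) (aap S) :=
  (eq_one_or_mem_of_mem_closure g.2).imp
    (fun h => congrArg (aapAction S) (Subtype.ext h : g = 1)) fun h => ⟨g, h, fun _ => rfl⟩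

theorem relCompact_range_aapAction [CompleteSpace E] (hM : ∀ R ∈ S, ‖R‖ ≤ M) (y : aap S) :
    RelCompact (Set.range fun g => aapAction S g y) := by
  have hK := (isCompact_singleton (x := y)).union (relCompact_image_restrictTo_aap hM y)
  refine hK.closure_of_subset ?_
  rintro _ ⟨g, rfl⟩
  rcases aapAction_eq_one_or_mem g with hg | hg
  · exact .inl (by simp [hg])
  · exact .inr (subset_closure ⟨_, hg, rfl⟩)

theorem IsAapProjection.commute_aapAction (hP : IsAapProjection S P)
    (hcomm : ∀ A ∈ S, ∀ B ∈ S, Commute A B) (g : Submonoid.closure (S : Set (E →L[𝕜] E))) :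
    Commute P (aapAction S g) := by
  rcases aapAction_eq_one_or_mem g with hg | hg
  · exact hg ▸ Commute.one_right P
  · exact commute_of_mem_sotClosure (fun _ hA _ hB => commute_of_mem_restrictTo hcomm hA hB)
      hP.mem_sotClosure (subset_sotClosure hg)

theorem IsAapProjection.norm_le_mul_norm_aapAction (hP : IsAapProjection S P)
    (hcomm : ∀ A ∈ S, ∀ B ∈ S, Commute A B) (hM : ∀ R ∈ S, ‖R‖ ≤ M)
    (g : Submonoid.closure (S : Set (E →L[𝕜] E))) {y : aap S}
    (hy : y ∈ LinearMap.range (P : aap S →ₗ[𝕜] aap S)) :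
    ‖y‖ ≤ max M 1 * ‖aapAction S g y‖ := by
  rcases aapAction_eq_one_or_mem g with hg | hg
  · rw [hg]
    exact le_mul_of_one_le_left (norm_nonneg y) (le_max_right M 1)
  · exact (IsJdLGProjection.norm_le hP (fun _ hA _ hB => commute_of_mem_restrictTo hcomm hA hB)
      (fun _ hA => norm_le_of_mem_restrictTo hM hA) hg hy).trans
      (mul_le_mul_of_nonneg_right (le_max_left M 1) (norm_nonneg _))

theorem sub_apply_mem_aap_of_mem_closure (hx : ∀ R ∈ S, x - R x ∈ aap S) {g : E →L[𝕜] E}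
    (hg : g ∈ Submonoid.closure (S : Set (E →L[𝕜] E))) : x - g x ∈ aap S := by
  rcases eq_one_or_mem_of_mem_closure hg with rfl | hg
  · simp
  · exact hx g hg

/-- The coboundary `g ↦ (I - g) x` of the action of the monoid `S ∪ {1}`. It need not be a
coboundary in `E_aap`, because only the differences are assumed to lie there. -/
def differenceCocycle (hx : ∀ R ∈ S, x - R x ∈ aap S)
    (g : Submonoid.closure (S : Set (E →L[𝕜] E))) : aap S :=
  ⟨x - (g : E →L[𝕜] E) x, sub_apply_mem_aap_of_mem_closure hx g.2⟩

theorem isCocycle_differenceCocycle (hx : ∀ R ∈ S, x - R x ∈ aap S) :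
    IsCocycle (aapAction S) (differenceCocycle hx) := fun g h => Subtype.ext <| by
  change x - (g : E →L[𝕜] E) ((h : E →L[𝕜] E) x) =
    x - (g : E →L[𝕜] E) x + (g : E →L[𝕜] E) (x - (h : E →L[𝕜] E) x)
  rw [map_sub, sub_add_sub_cancel]

theorem norm_differenceCocycle_le (hM : ∀ R ∈ S, ‖R‖ ≤ M) (hx : ∀ R ∈ S, x - R x ∈ aap S)
    (g : Submonoid.closure (S : Set (E →L[𝕜] E))) :
    ‖differenceCocycle hx g‖ ≤ ‖x‖ + max M 1 * ‖x‖ :=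
  (norm_sub_le _ _).trans <| add_le_add_right
    ((g : E →L[𝕜] E).le_of_opNorm_le (norm_le_of_mem_closure hM g.2) x) _

theorem IsAapProjection.totallyBounded_range_differenceCocycle [CompleteSpace E]
    (hP : IsAapProjection S P) (hc0 : ¬ ContainsCZero 𝕜 E)
    (hcomm : ∀ A ∈ S, ∀ B ∈ S, Commute A B) (hM : ∀ R ∈ S, ‖R‖ ≤ M)
    (hdvd : WellQuasiOrdered fun A B : Submonoid.closure (S : Set (E →L[𝕜] E)) => A ∣ B)
    (hx : ∀ R ∈ S, x - R x ∈ aap S) :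
    TotallyBounded (Set.range fun g => P (differenceCocycle hx g)) := by
  have : CompleteSpace (aap S) := (isClosed_aap hM).completeSpace_coe
  have isCocycle_P := (isCocycle_differenceCocycle hx).map (hP.commute_aapAction hcomm)
  exact isCocycle_P.totallyBounded_range (fun h => hc0 (ContainsCZero.of_submodule h))
    (fun g => P.le_opNorm_of_le (norm_differenceCocycle_le hM hx g)) (norm_aapAction_le hM)
    (LinearMap.mem_range_self (P : aap S →ₗ[𝕜] aap S) <| differenceCocycle hx ·)
    (fun g _ hy => hP.norm_le_mul_norm_aapAction hcomm hM g hy)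
    (fun _ => relCompact_range_aapAction hM _) hdvd

theorem relCompact_stableDifferences [CompleteSpace E] (hM : ∀ R ∈ S, ‖R‖ ≤ M)
    (P : aap S →L[𝕜] aap S) (hx : x ∈ aap S) : RelCompact (stableDifferences S P x) := by
  let d : aap S → aap S := fun w => ⟨x, hx⟩ - w
  refine (relCompact_image_restrictTo_aap hM ⟨x, hx⟩).of_subset_image
    (f := fun w => ((d w - P (d w) : aap S) : E)) (by fun_prop) ?_
  rintro _ ⟨R, hR, y, hy, rfl⟩
  obtain ⟨A, hA, hAR⟩ := exists_restrictTo_aap hR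
  have hdy : d (A ⟨x, hx⟩) = y := Subtype.ext ((congrArg (x - ·) (hAR ⟨x, hx⟩)).trans hy.symm)
  exact ⟨_, ⟨A, hA, rfl⟩, by simp only [hdy, Submodule.coe_sub]⟩

theorem IsAapProjection.mem_aap_of_relCompact_stableDifferences [CompleteSpace E]
    (hP : IsAapProjection S P) (hc0 : ¬ ContainsCZero 𝕜 E)
    (hcomm : ∀ A ∈ S, ∀ B ∈ S, Commute A B) (hM : ∀ R ∈ S, ‖R‖ ≤ M)
    (hdvd : WellQuasiOrdered fun A B : Submonoid.closure (S : Set (E →L[𝕜] E)) => A ∣ B)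
    (hx : ∀ R ∈ S, x - R x ∈ aap S) (hst : RelCompact (stableDifferences S P x)) :
    x ∈ aap S := by
  have : CompleteSpace (aap S) := (isClosed_aap hM).completeSpace_coe
  let c := differenceCocycle hx
  have relCompact_P : RelCompact (Set.range fun g => (P (c g) : E)) :=
    (relCompact_iff_totallyBounded.2
      (hP.totallyBounded_range_differenceCocycle hc0 hcomm hM hdvd hx)).of_subset_image
      continuous_subtype_val (Set.range_comp _ _).subset
  have relCompact_differences : RelCompact ((fun R : E →L[𝕜] E => x - R x) '' S) := by
    refine relCompact_add relCompact_P hst ?_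
    rintro _ ⟨R, hR, rfl⟩
    let g : Submonoid.closure (S : Set (E →L[𝕜] E)) := ⟨R, Submonoid.subset_closure hR⟩
    exact ⟨_, ⟨g, rfl⟩, _, ⟨R, hR, c g, rfl, rfl⟩, add_sub_cancel _ _⟩
  refine relCompact_differences.of_subset_image (f := (x - ·)) (by fun_prop) ?_
  rintro _ ⟨R, hR, rfl⟩
  exact ⟨_, ⟨R, hR, rfl⟩, sub_sub_self x (R x)⟩

end AlmostPeriodic

end OrbitCompactness

open OrbitCompactness in
theorem proposition3p9_general {𝕜 : Type*} [RCLike 𝕜] {E : Type*} [NormedAddCommGroup E]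
    [NormedSpace 𝕜 E] [CompleteSpace E] (hc0 : ¬ ContainsCZero 𝕜 E)
    {S : Subsemigroup (E →L[𝕜] E)} (hne : (S : Set (E →L[𝕜] E)).Nonempty)
    (hcomm : ∀ A ∈ S, ∀ B ∈ S, Commute A B) {M : ℝ} (hM : ∀ R ∈ S, ‖R‖ ≤ M)
    (hdvd : WellQuasiOrdered fun A B : Submonoid.closure (S : Set (E →L[𝕜] E)) => A ∣ B) :
    (∃! P, IsAapProjection S P) ∧ ∀ P, IsAapProjection S P → ∀ x : E,
      RelCompact (orbit S x) ↔
        (∀ R ∈ S, RelCompact (orbit S (x - R x))) ∧ RelCompact (stableDifferences S P x) := by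
  refine ⟨existsUnique_isAapProjection hne hcomm hM, fun P hP x => ⟨fun hx => ⟨fun R hR => ?_, ?_⟩,
    fun ⟨hdiff, hst⟩ => ?_⟩⟩
  · exact sub_mem (mem_aap.2 hx) (apply_mem_aap hR hx)
  · exact relCompact_stableDifferences hM P hx
  · exact hP.mem_aap_of_relCompact_stableDifferences hc0 hcomm hM hdvd hdiff hst

theorem proposition3p9 {𝕜 : Type*} [RCLike 𝕜] {E : Type*} [NormedAddCommGroup E]
    [NormedSpace 𝕜 E] [CompleteSpace E] (hc0 : ¬ OrbitCompactness.ContainsCZero 𝕜 E)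
    {m : ℕ} (hm : 0 < m) (T : Fin m → E →L[𝕜] E)
    (hcomm : ∀ i j, Commute (T i) (T j))
    (hpb : ∀ j, OrbitCompactness.IsPowerBounded (T j)) :
    (∃! P, OrbitCompactness.IsAapProjection (OrbitCompactness.generatedSemigroup T) P) ∧
    ∀ P, OrbitCompactness.IsAapProjection (OrbitCompactness.generatedSemigroup T) P →
      ∀ x : E,
        OrbitCompactness.RelCompact
            (OrbitCompactness.orbit (OrbitCompactness.generatedSemigroup T) x) ↔
          (∀ j, OrbitCompactness.RelCompact
            (OrbitCompactness.orbit (OrbitCompactness.generatedSemigroup T) (x - T j x))) ∧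
          OrbitCompactness.RelCompact
            (OrbitCompactness.stableDifferences (OrbitCompactness.generatedSemigroup T) P x) := by
  obtain ⟨M, hM⟩ := OrbitCompactness.exists_norm_le_of_mem_generatedSemigroup hcomm hpb
  simpa only [OrbitCompactness.forall_mem_generatedSemigroup_relCompact_orbit_sub_iff] using
    proposition3p9_general (S := OrbitCompactness.generatedSemigroup T) hc0
      ⟨T ⟨0, hm⟩, Subsemigroup.subset_closure ⟨_, rfl⟩⟩
      (OrbitCompactness.commute_of_mem_generatedSemigroup hcomm) hM
      (OrbitCompactness.wellQuasiOrdered_dvd_closure_generatedSemigroup hcomm)
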